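/- Let $n\ge 4$, and index the coordinates of words $x\in\{0,1\}^n$ by $\mathbb{Z}/n\mathbb{Z}$. Let $\sigma_n$ be the cyclic shift, $\sigma_n(x)_i=x_{i+1}$. For $N\in\{57,99\}$ let $e^N_n:\{0,1\}^n\to\{0,1\}^n$ be the asynchronous application at cell $0$ of the elementary cellular automaton with Wolfram number $N$: writing $N=(b_{111}b_{110}b_{101}b_{100}b_{011}b_{010}b_{001}b_{000})_2$, set $e^N_n(x)_0=b_{x_{-1}x_0x_1}$ and $e^N_n(x)_i=x_i$ for $i\ne 0$. (Thus $e^{57}_n$ flips $x_0$ unless $x_{-1}=0$ and $x_1=1$, and $e^{99}_n$ flips $x_0$ unless $x_{-1}=1$ and $x_1=0$.) These maps are permutations of $\{0,1\}^n$, and $$\langle e^{57}_n,\sigma_n\rangle=\langle e^{99}_n,\sigma_n\rangle=\mathrm{Alt}(\{0,1\}^n).$$ -/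

import Mathlib

/-- The local rule of the elementary cellular automaton with Wolfram number `N`: the new value of a
cell is the binary digit of `N` whose place is the number `(l c r)₂`, where `l, c, r` are the values
of the left neighbour, the cell itself and the right neighbour. So the leading digit of the 8-digit
binary expansion of `N` belongs to `111`, the next one to `110`, and so on down to `000`. -/
def wolframRule (N : ℕ) (l c r : Bool) : Bool :=
  N.testBit (4 * l.toNat + 2 * c.toNat + r.toNat)

/-- The rule `N` is reversible in the central cell: for all values of the two neighbours, applying
it twice restores the cell (for maps of `{0,1}` to itself, being an involution is the same as being
a bijection). -/
def IsCellReversible (N : ℕ) : Prop :=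
  ∀ l r c : Bool, wolframRule N l (wolframRule N l c r) r = c

theorem isCellReversible_57 : IsCellReversible 57 := by
  unfold IsCellReversible; decide

theorem isCellReversible_99 : IsCellReversible 99 := by
  unfold IsCellReversible; decide

/-- Asynchronous application of the elementary cellular automaton `N` on the cycle `ℤ/nℤ`: cell `0`
is updated according to the values in the cells `-1, 0, 1`, and no other cell is changed. -/
def ringGateFun (n N : ℕ) (x : ZMod n → Bool) : ZMod n → Bool :=
  Function.update x 0 (wolframRule N (x (-1)) (x 0) (x 1))

theorem ringGateFun_involutive {n N : ℕ} (hn : 2 ≤ n) (hN : IsCellReversible N) :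
    Function.Involutive (ringGateFun n N) := by
  intro x
  have : Fact (1 < n) := ⟨hn⟩
  have h1 : (1 : ZMod n) ≠ 0 := one_ne_zero
  have h2 : (-1 : ZMod n) ≠ 0 := neg_ne_zero.mpr h1
  simp [ringGateFun, hN _ _ _]

/-- The gate `e^N` on the cycle `ℤ/nℤ`, as a permutation of `{0,1}^n`. -/
def ringGate (n N : ℕ) (hn : 2 ≤ n) (hN : IsCellReversible N) : Equiv.Perm (ZMod n → Bool) :=
  (ringGateFun_involutive hn hN).toPerm

/-- The cyclic shift `σ_n(x)_i = x_{i+1}` on `{0,1}^n`, with indices in `ℤ/nℤ`. -/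
def ringShift (n : ℕ) : Equiv.Perm (ZMod n → Bool) where
  toFun x := fun i => x (i + 1)
  invFun x := fun i => x (i - 1)
  left_inv x := by funext i; simp
  right_inv x := by funext i; simp

/-! The facts below are not used by the definitions above. They check that these agree with the
gates on the cycle which are induced by the gates and the shift on the line `{0,1}^ℤ`. -/

/-- The power `σ^m` of the shift on `{0,1}^ℤ`. -/
def lineShift (m : ℤ) (x : ℤ → Bool) : ℤ → Bool := fun i => x (i + m)

/-- The gate `e^N` on `{0,1}^ℤ`. -/
def lineGate (N : ℕ) (x : ℤ → Bool) : ℤ → Bool :=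
  Function.update x 0 (wolframRule N (x (-1)) (x 0) (x 1))

/-- The `n`-periodic point `...www...` of `{0,1}^ℤ`. -/
def periodicPoint {n : ℕ} (w : ZMod n → Bool) : ℤ → Bool := fun i => w (i : ZMod n)

/-- The composition of the maps `σ^{-in} ∘ g ∘ σ^{in}` over the `i` in a list. -/
def shiftedProduct (n : ℕ) (g : (ℤ → Bool) → (ℤ → Bool)) (l : List ℤ) : (ℤ → Bool) → (ℤ → Bool) :=
  l.foldr (fun i h => lineShift (-(i * n)) ∘ g ∘ lineShift (i * n) ∘ h) id

theorem shiftedProduct_lineGate {n N : ℕ} (hn : 2 ≤ n) (l : List ℤ) (hl : l.Nodup)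
    (x : ℤ → Bool) (j : ℤ) :
    ((∀ i ∈ l, j ≠ i * n) → shiftedProduct n (lineGate N) l x j = x j) ∧
    ((∃ i ∈ l, j = i * n) → shiftedProduct n (lineGate N) l x j =
      wolframRule N (x (j - 1)) (x j) (x (j + 1))) := by
  induction l generalizing j with
  | nil => simp [shiftedProduct]
  | cons a l ih =>
    obtain ⟨ha, hl⟩ := List.nodup_cons.mp hl
    have ih := ih hl
    have hn0 : (n : ℤ) ≠ 0 := by omega
    have key : ∀ j, shiftedProduct n (lineGate N) (a :: l) x j =
        if j = a * n then wolframRule N (shiftedProduct n (lineGate N) l x (a * n - 1))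
          (shiftedProduct n (lineGate N) l x (a * n))
          (shiftedProduct n (lineGate N) l x (a * n + 1))
        else shiftedProduct n (lineGate N) l x j := by
      intro j
      have : shiftedProduct n (lineGate N) (a :: l) x j =
        lineShift (-(a * n)) (lineGate N (lineShift (a * n) (shiftedProduct n (lineGate N) l x))) j
        := rfl
      rw [this]
      by_cases h : j = a * n
      · subst h
        simp only [lineShift, lineGate]
        simp [add_comm, sub_eq_add_neg]
      · have h' : j + -(a * n) ≠ 0 := by omega
        rw [if_neg h]
        simp only [lineShift, lineGate]
        rw [Function.update_of_ne h']
        simp [lineShift]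
    have hside : ∀ e : ℤ, (e = 1 ∨ e = -1) →
        shiftedProduct n (lineGate N) l x (a * n + e) = x (a * n + e) := by
      intro e he
      refine (ih _).1 fun i _ hi => ?_
      have hd : (n : ℤ) ∣ e := ⟨i - a, by linarith⟩
      have : (n : ℤ) ∣ 1 := by
        rcases he with rfl | rfl
        · exact hd
        · simpa using hd
      have := Int.le_of_dvd one_pos this
      omega
    have hmid : shiftedProduct n (lineGate N) l x (a * n) = x (a * n) := by
      refine (ih _).1 fun i hi h => ha ?_
      rwa [mul_right_cancel₀ hn0 h]
    rw [key]
    constructor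
    · intro h
      rw [if_neg (h a (by simp))]
      exact (ih j).1 fun i hi => h i (by simp [hi])
    · rintro ⟨i, hi, rfl⟩
      split_ifs with h
      · rw [h, hmid, hside 1 (Or.inl rfl), sub_eq_add_neg, hside (-1) (Or.inr rfl)]
      · refine (ih _).2 ⟨i, ?_, rfl⟩
        rcases List.mem_cons.mp hi with rfl | hi
        · exact absurd rfl h
        · exact hi

/-- On `n`-periodic points, `ringGateFun n N` is the limit, as `k → ∞`, of the compositions over
`i = -k, ..., k` of the maps `σ^{-in} ∘ e^N ∘ σ^{in}` on the line. -/
theorem tendsto_shiftedProduct_lineGate {n N : ℕ} (hn : 2 ≤ n) (w : ZMod n → Bool) :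
    Filter.Tendsto (fun k : ℕ => shiftedProduct n (lineGate N)
      ((List.range (2 * k + 1)).map fun t : ℕ => (t : ℤ) - k) (periodicPoint w))
      Filter.atTop (nhds (periodicPoint (ringGateFun n N w))) := by
  rw [tendsto_pi_nhds]
  intro j
  refine tendsto_const_nhds.congr' ?_
  filter_upwards [Filter.eventually_ge_atTop j.natAbs] with k hk
  have hnd : ((List.range (2 * k + 1)).map fun t : ℕ => (t : ℤ) - k).Nodup :=
    List.nodup_range.map fun a b h => by simpa using h
  have main := shiftedProduct_lineGate (N := N) hn _ hnd (periodicPoint w) j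
  by_cases h : (j : ZMod n) = 0
  · obtain ⟨i, hi⟩ := (ZMod.intCast_zmod_eq_zero_iff_dvd j n).mp h
    rw [main.2 ⟨i, ?_, by rw [hi, mul_comm]⟩]
    · simp [periodicPoint, ringGateFun, h]
    · have hik : i.natAbs ≤ k := by
        refine le_trans ?_ hk
        rw [hi, Int.natAbs_mul]
        exact Nat.le_mul_of_pos_left _ (by omega)
      exact List.mem_map.mpr ⟨(i + k).toNat, List.mem_range.mpr (by omega), by omega⟩
  · rw [main.1]
    · simp [periodicPoint, ringGateFun, Function.update_of_ne h]
    · rintro i - rfl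
      exact h (by simp)

theorem lineShift_periodicPoint {n : ℕ} (w : ZMod n → Bool) :
    lineShift 1 (periodicPoint w) = periodicPoint (ringShift n w) := by
  funext i
  simp [lineShift, periodicPoint, ringShift]

/-! Call two words equivalent if they are equal or lie on a common 3-cycle of the group `G`. Two
3-cycles of `G` sharing a point generate every 3-cycle on their union (`HasCyc3.merge`), so this is
an equivalence relation, permuted by `G`, and every 3-cycle inside a class belongs to `G`. If there
is only one class, then `G` contains the alternating group.

To find 3-cycles, cut the cycle into a segment whose first letter is 0 and last letter is 1, and use
only the gates at interior cells, which preserve these two letters. On four cells a power of a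
product of two gates is a 3-cycle. For longer segments, 3-cycles acting on the left and on the right
part are combined: if two permutations have exactly one common moved point, their commutator is a
3-cycle (`commutator_eq_cyc3`). By induction all words with these end letters are equivalent once
the segment has at least 5 cells (`sectorConnected`).

On a cycle with n ≥ 5, every nonconstant word has a factor 10 somewhere, hence lies in such a
sector. Sectors whose cuts are not adjacent intersect, which joins all of them, and the gate joins
the constant words to the rest. The case n = 4 is a separate computation (`cyc3Rel_ringGroup_four`).

Conversely, for n ≥ 4 the generators are even, because a permutation of words that ignores a cell
acts identically on two halves. Complementing all letters conjugates rule 57 to rule 99 and commutes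
with the shift. -/

open Equiv

/-! ### Three-cycles in a permutation group -/

/-- The permutation `a ↦ b ↦ c ↦ a`, for distinct `a`, `b`, `c`. -/
def cyc3 {α : Type*} [DecidableEq α] (a b c : α) : Perm α := swap a b * swap b c

/-- The points `a`, `b`, `c` are distinct and the 3-cycle through them lies in `G`. -/
def HasCyc3 {α : Type*} [DecidableEq α] (G : Subgroup (Perm α)) (a b c : α) : Prop :=
  a ≠ b ∧ a ≠ c ∧ b ≠ c ∧ cyc3 a b c ∈ G

/-- The points `a` and `b` are equal or lie on a common 3-cycle of `G`. -/
def Cyc3Rel {α : Type*} [DecidableEq α] (G : Subgroup (Perm α)) (a b : α) : Prop :=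
  a = b ∨ ∃ c, HasCyc3 G a b c

section ThreeCycles

variable {α : Type*} [DecidableEq α] {G : Subgroup (Perm α)} {a b c d e : α}

theorem cyc3_apply_left (hab : a ≠ b) (hac : a ≠ c) : cyc3 a b c a = b := by
  simp [cyc3, swap_apply_of_ne_of_ne hab hac]

theorem cyc3_apply_mid (hac : a ≠ c) (hbc : b ≠ c) : cyc3 a b c b = c := by
  simp [cyc3, swap_apply_of_ne_of_ne hac.symm hbc.symm]

theorem cyc3_apply_right : cyc3 a b c c = a := by
  simp [cyc3]

theorem cyc3_apply_of_ne (ha : d ≠ a) (hb : d ≠ b) (hc : d ≠ c) : cyc3 a b c d = d := by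
  simp [cyc3, swap_apply_of_ne_of_ne hb hc, swap_apply_of_ne_of_ne ha hb]

theorem cyc3_conj (g : Perm α) (a b c : α) : g * cyc3 a b c * g⁻¹ = cyc3 (g a) (g b) (g c) := by
  simp [cyc3, swap_apply_apply, mul_assoc]

theorem cyc3_rotate (hab : a ≠ b) (hac : a ≠ c) (hbc : b ≠ c) : cyc3 b c a = cyc3 a b c := by
  ext x
  by_cases ha : x = a
  · subst ha; rw [cyc3_apply_right, cyc3_apply_left hab hac]
  by_cases hb : x = b
  · subst hb; rw [cyc3_apply_left hbc hab.symm, cyc3_apply_mid hac hbc]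
  by_cases hc : x = c
  · subst hc; rw [cyc3_apply_mid hab.symm hac.symm, cyc3_apply_right]
  rw [cyc3_apply_of_ne hb hc ha, cyc3_apply_of_ne ha hb hc]

theorem cyc3_inv (a b c : α) : (cyc3 a b c)⁻¹ = cyc3 c b a := by
  simp [cyc3, swap_comm]

/-- If only `z` is moved by both `σ` and `τ`, then their commutator is a 3-cycle. -/
theorem commutator_eq_cyc3 {σ τ : Perm α} {z : α} (hσ : σ z ≠ z) (hτ : τ z ≠ z)
    (h : ∀ x, σ x ≠ x → τ x ≠ x → x = z) : σ * τ * σ⁻¹ * τ⁻¹ = cyc3 z (σ z) (τ z) := by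
  have hτσ : τ (σ z) = σ z := by
    by_contra h'
    exact hσ (h _ (fun h'' => hσ (σ.injective h'')) h')
  have hστ : σ (τ z) = τ z := by
    by_contra h'
    exact hτ (h _ h' (fun h'' => hτ (τ.injective h'')))
  have hne : σ z ≠ τ z := fun h' => by
    rw [← h'] at hστ
    exact hσ (σ.injective hστ)
  -- Away from `z` each point is fixed by `σ` or by `τ`; this form of the identity avoids evaluating
  -- inverses.
  have key : σ * τ = cyc3 z (σ z) (τ z) * (τ * σ) := by
    ext x
    simp only [Perm.mul_apply]
    by_cases hx : x = z
    · subst hx; rw [hτσ, hστ, cyc3_apply_mid hτ.symm hne]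
    by_cases h1 : σ x = x
    · rw [h1]
      by_cases h2 : τ x = x
      · rw [h2, h1, cyc3_apply_of_ne hx]
        · rintro rfl; exact hσ (σ.injective h1)
        · rintro rfl; exact hτ (τ.injective h2)
      · by_cases h3 : τ x = z
        · rw [h3, cyc3_apply_left hσ.symm hτ.symm]
        · have h4 : σ (τ x) = τ x := by
            by_contra h'
            exact h3 (h _ h' (fun h'' => h2 (τ.injective h'')))
          rw [h4, cyc3_apply_of_ne h3]
          · intro h5
            rw [h5] at h4
            exact hσ (σ.injective h4)
          · intro h5; exact hx (τ.injective h5)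
    · have h2 : τ x = x := by
        by_contra h'
        exact hx (h _ h1 h')
      rw [h2]
      by_cases h3 : σ x = z
      · rw [h3, cyc3_apply_right]
      · have h4 : τ (σ x) = σ x := by
          by_contra h'
          exact h3 (h _ (fun h'' => h1 (σ.injective h'')) h')
        rw [h4, cyc3_apply_of_ne h3]
        · intro h5; exact hx (σ.injective h5)
        · intro h5
          rw [h5] at h4
          exact hτ (τ.injective h4)
  rw [key]
  group

namespace HasCyc3

theorem rotate (h : HasCyc3 G a b c) : HasCyc3 G b c a :=
  ⟨h.2.2.1, h.1.symm, h.2.1.symm, by rw [cyc3_rotate h.1 h.2.1 h.2.2.1]; exact h.2.2.2⟩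

theorem reverse (h : HasCyc3 G a b c) : HasCyc3 G c b a :=
  ⟨h.2.2.1.symm, h.2.1.symm, h.1.symm, by rw [← cyc3_inv]; exact G.inv_mem h.2.2.2⟩

theorem conj {g : Perm α} (hg : g ∈ G) (h : HasCyc3 G a b c) : HasCyc3 G (g a) (g b) (g c) :=
  ⟨g.injective.ne h.1, g.injective.ne h.2.1, g.injective.ne h.2.2.1, by
    rw [← cyc3_conj]; exact G.mul_mem (G.mul_mem hg h.2.2.2) (G.inv_mem hg)⟩

/-- Two 3-cycles with a common point `b` produce 3-cycles through any two further points. -/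
theorem merge (h : HasCyc3 G a b c) (h' : HasCyc3 G b d e) (had : a ≠ d) : HasCyc3 G a b d := by
  obtain ⟨hab, hac, hbc, hm⟩ := id h
  obtain ⟨hbd, hbe, hde, hm'⟩ := id h'
  by_cases hcd : c = d
  · exact hcd ▸ h
  by_cases hea : e = a
  · exact (hea ▸ h').rotate.rotate
  by_cases hce : c = e
  · have := h.conj hm'
    rw [cyc3_apply_left hbd hbe, cyc3_apply_of_ne hab had (Ne.symm hea), hce,
      cyc3_apply_right] at this
    exact this.reverse.rotate.rotate
  -- Five distinct points: conjugating (b d e) by (a b c) gives (c d e), and conjugating (a b c) by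
  -- (c d e) gives (a b d).
  · have h1 := h'.conj hm
    rw [cyc3_apply_mid hac hbc, cyc3_apply_of_ne had.symm hbd.symm (Ne.symm hcd),
      cyc3_apply_of_ne hea hbe.symm (Ne.symm hce)] at h1
    have h2 := h.conj h1.2.2.2
    rwa [cyc3_apply_of_ne hac had (Ne.symm hea), cyc3_apply_of_ne hbc hbd hbe,
      cyc3_apply_left hcd hce] at h2

theorem rel_left (h : HasCyc3 G a b c) : Cyc3Rel G a b := Or.inr ⟨c, h⟩

theorem rel_right (h : HasCyc3 G a b c) : Cyc3Rel G a c := Or.inr ⟨b, h.reverse.rotate.rotate⟩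

end HasCyc3

namespace Cyc3Rel

theorem refl (G : Subgroup (Perm α)) (a : α) : Cyc3Rel G a a := Or.inl rfl

theorem symm (h : Cyc3Rel G a b) : Cyc3Rel G b a := by
  rcases h with rfl | ⟨c, h⟩
  · exact refl G _
  · exact Or.inr ⟨c, h.reverse.rotate⟩

theorem hasCyc3 (h : Cyc3Rel G a b) (h' : Cyc3Rel G b c) (hab : a ≠ b) (hac : a ≠ c)
    (hbc : b ≠ c) : HasCyc3 G a b c := by
  obtain ⟨d, h⟩ := h.resolve_left hab
  obtain ⟨e, h'⟩ := h'.resolve_left hbc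
  exact h.merge h' hac

theorem trans (h : Cyc3Rel G a b) (h' : Cyc3Rel G b c) : Cyc3Rel G a c := by
  by_cases hab : a = b
  · exact hab ▸ h'
  by_cases hbc : b = c
  · exact hbc ▸ h
  by_cases hac : a = c
  · exact Or.inl hac
  · exact (h.hasCyc3 h' hab hac hbc).rel_right

theorem apply {g : Perm α} (hg : g ∈ G) (h : Cyc3Rel G a b) : Cyc3Rel G (g a) (g b) := by
  rcases h with rfl | ⟨c, h⟩
  · exact refl G _
  · exact Or.inr ⟨g c, h.conj hg⟩

/-- An element of `G` which maps one point of a class into the class preserves the class. -/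
theorem apply_of_apply {g : Perm α} (hg : g ∈ G) (hac : Cyc3Rel G a c) (hag : Cyc3Rel G a (g c))
    (hab : Cyc3Rel G a b) : Cyc3Rel G a (g b) :=
  hag.trans ((hac.symm.trans hab).apply hg)

theorem map {β : Type*} [DecidableEq β] {H : Subgroup (Perm β)} (φ : α ≃ β)
    (hφ : ∀ g ∈ G, φ.permCongr g ∈ H) (h : Cyc3Rel G a b) : Cyc3Rel H (φ a) (φ b) := by
  rcases h with rfl | ⟨c, hab, hac, hbc, h⟩
  · exact refl H _
  · refine Or.inr ⟨φ c, φ.injective.ne hab, φ.injective.ne hac, φ.injective.ne hbc, ?_⟩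
    have := hφ _ h
    rwa [show φ.permCongr (cyc3 a b c) = cyc3 (φ a) (φ b) (φ c) by
      ext x
      simp [cyc3, swap_apply_def, Equiv.symm_apply_eq, apply_ite φ]] at this

end Cyc3Rel

/-- The 3-cycles generate the alternating group, and each of them runs inside the single class. -/
theorem alternatingGroup_le_of_cyc3Rel [Fintype α] (h : ∀ a b, Cyc3Rel G a b) :
    alternatingGroup α ≤ G := by
  rw [← Perm.closure_three_cycles_eq_alternating, Subgroup.closure_le]
  intro f hf
  obtain ⟨a, b, c, hab, hac, hbc, rfl⟩ : ∃ a b c, a ≠ b ∧ a ≠ c ∧ b ≠ c ∧ f = cyc3 a b c := by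
    have hf : f.IsThreeCycle := hf
    obtain ⟨a, ha⟩ := hf.isCycle.nonempty_support
    have hnd := hf.nodup_iff_mem_support.mpr ha
    simp only [List.nodup_cons, List.mem_cons, List.not_mem_nil, or_false, not_or] at hnd
    exact ⟨a, f a, f (f a), hnd.1.1, hnd.1.2, hnd.2.1, hf.eq_swap_mul_swap_iff_mem_support.mpr ha⟩
  exact ((h a b).hasCyc3 (h b c) hab hac hbc).2.2.2

end ThreeCycles

/-! ### Permutations acting on part of the cells -/

section ExtendPerm

variable {ι κ : Type*}

/-- A permutation of `{0,1}^ι`, acting on the coordinates in the image of `f : ι → κ`. -/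
noncomputable def extendPerm (f : ι → κ) (hf : f.Injective) :
    Perm (ι → Bool) →* Perm (κ → Bool) where
  toFun π :=
    { toFun := fun y => Function.extend f (π (y ∘ f)) y
      invFun := fun y => Function.extend f (π.symm (y ∘ f)) y
      left_inv := fun y => by
        ext j
        by_cases hj : ∃ i, f i = j
        · obtain ⟨i, rfl⟩ := hj
          simp [hf.extend_apply, Function.extend_comp hf]
        · simp [Function.extend_apply' _ _ _ hj]
      right_inv := fun y => by
        ext j
        by_cases hj : ∃ i, f i = j
        · obtain ⟨i, rfl⟩ := hj
          simp [hf.extend_apply, Function.extend_comp hf]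
        · simp [Function.extend_apply' _ _ _ hj] }
  map_one' := by
    ext y j
    by_cases hj : ∃ i, f i = j
    · obtain ⟨i, rfl⟩ := hj
      simp [hf.extend_apply]
    · simp [Function.extend_apply' _ _ _ hj]
  map_mul' π ρ := by
    ext y j
    by_cases hj : ∃ i, f i = j
    · obtain ⟨i, rfl⟩ := hj
      simp [hf.extend_apply, Function.extend_comp hf]
    · simp [Function.extend_apply' _ _ _ hj]

variable {f : ι → κ} (hf : f.Injective)

theorem extendPerm_apply (π : Perm (ι → Bool)) (y : κ → Bool) (i : ι) :
    extendPerm f hf π y (f i) = π (y ∘ f) i :=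
  hf.extend_apply _ _ _

theorem extendPerm_apply_of_notMem (π : Perm (ι → Bool)) (y : κ → Bool) {j : κ}
    (hj : ¬∃ i, f i = j) : extendPerm f hf π y j = y j :=
  Function.extend_apply' _ _ _ hj

theorem extendPerm_ne {π : Perm (ι → Bool)} {y : κ → Bool} (h : extendPerm f hf π y ≠ y) :
    π (y ∘ f) ≠ y ∘ f := fun h' => h <| by
  ext j
  by_cases hj : ∃ i, f i = j
  · obtain ⟨i, rfl⟩ := hj
    rw [extendPerm_apply, h', Function.comp]
  · rw [extendPerm_apply_of_notMem hf _ _ hj]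

theorem extendPerm_eq {π : Perm (ι → Bool)} {y w : κ → Bool} (h : π (y ∘ f) = w ∘ f)
    (h' : ∀ j, (¬∃ i, f i = j) → y j = w j) : extendPerm f hf π y = w := by
  ext j
  by_cases hj : ∃ i, f i = j
  · obtain ⟨i, rfl⟩ := hj
    rw [extendPerm_apply, h, Function.comp]
  · rw [extendPerm_apply_of_notMem hf _ _ hj, h' j hj]

end ExtendPerm

/-! ### The gate of rule 57 at an arbitrary cell -/

section CellGates

variable {ι κ : Type*} [DecidableEq ι] [DecidableEq κ]

/-- The gate on `{0,1}^ι` which flips the cell `c` unless `l` has value `0` and `r` value `1`. -/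
def cellGate (l c r : ι) (hl : l ≠ c) (hr : r ≠ c) : Perm (ι → Bool) :=
  Function.Involutive.toPerm
    (fun x => Function.update x c (xor (x c) (x l || !x r))) fun x => by
      simp [hl, hr]

theorem cellGate_apply (l c r : ι) (hl : l ≠ c) (hr : r ≠ c) (x : ι → Bool) :
    cellGate l c r hl hr x = Function.update x c (xor (x c) (x l || !x r)) := rfl

theorem cellGate_apply_of_ne {l c r i : ι} (hl : l ≠ c) (hr : r ≠ c) (x : ι → Bool)
    (hi : i ≠ c) : cellGate l c r hl hr x i = x i := by
  simp [cellGate_apply, hi]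

theorem cellGate_apply_self (l c r : ι) (hl : l ≠ c) (hr : r ≠ c) (x : ι → Bool) :
    cellGate l c r hl hr x c = xor (x c) (x l || !x r) := by
  simp [cellGate_apply]

theorem cellGate_cellGate {l c r : ι} (hl : l ≠ c) (hr : r ≠ c) (x : ι → Bool) :
    cellGate l c r hl hr (cellGate l c r hl hr x) = x :=
  (cellGate l c r hl hr).left_inv x

theorem extendPerm_cellGate {f : ι → κ} (hf : f.Injective) {l c r : ι} (hl : l ≠ c) (hr : r ≠ c) :
    extendPerm f hf (cellGate l c r hl hr) =
      cellGate (f l) (f c) (f r) (hf.ne hl) (hf.ne hr) := by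
  ext1 y
  refine extendPerm_eq hf ?_ fun j hj => (cellGate_apply_of_ne _ _ _ fun h => hj ⟨c, h.symm⟩).symm
  ext i
  by_cases hi : i = c
  · subst hi; simp [cellGate_apply_self]
  · rw [cellGate_apply_of_ne _ _ _ hi, Function.comp_apply, Function.comp_apply,
      cellGate_apply_of_ne _ _ _ (hf.ne hi)]

theorem permCongr_cellGate (φ : ι ≃ κ) {l c r : ι} (hl : l ≠ c) (hr : r ≠ c) :
    (φ.arrowCongr (Equiv.refl Bool)).permCongr (cellGate l c r hl hr) =
      cellGate (φ l) (φ c) (φ r) (φ.injective.ne hl) (φ.injective.ne hr) := by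
  ext y j
  obtain ⟨i, rfl⟩ := φ.surjective j
  by_cases hi : i = c
  · subst hi; simp [cellGate_apply_self, Equiv.permCongr_apply, Equiv.arrowCongr]
  · rw [cellGate_apply_of_ne _ _ _ (φ.injective.ne hi)]
    simp [Equiv.permCongr_apply, Equiv.arrowCongr, cellGate_apply_of_ne _ _ _ hi]

end CellGates

/-! ### Segments with end letters 0 and 1: the induction step -/

section Segments

/-- The gate at the cell `j + 1` of the segment `{0, …, k - 1}`. -/
def segmentGate {k : ℕ} (j : ℕ) (hj : j + 2 < k) : Perm (Fin k → Bool) :=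
  cellGate ⟨j, by omega⟩ ⟨j + 1, by omega⟩ ⟨j + 2, hj⟩ (by simp) (by simp)

/-- The group generated by the gates at the interior cells of the segment `{0, …, k - 1}`. -/
def segmentGroup (k : ℕ) : Subgroup (Perm (Fin k → Bool)) :=
  Subgroup.closure {g | ∃ (j : ℕ) (hj : j + 2 < k), g = segmentGate j hj}

theorem segmentGate_mem {k j : ℕ} (hj : j + 2 < k) : segmentGate j hj ∈ segmentGroup k :=
  Subgroup.subset_closure ⟨j, hj, rfl⟩

theorem extendPerm_castSucc_mem {k : ℕ} {π : Perm (Fin k → Bool)} (hπ : π ∈ segmentGroup k) :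
    extendPerm _ (Fin.castSucc_injective k) π ∈ segmentGroup (k + 1) := by
  suffices segmentGroup k ≤
      (segmentGroup (k + 1)).comap (extendPerm _ (Fin.castSucc_injective k)) from this hπ
  rw [segmentGroup, Subgroup.closure_le]
  rintro _ ⟨j, hj, rfl⟩
  rw [SetLike.mem_coe, Subgroup.mem_comap, segmentGate, extendPerm_cellGate]
  exact segmentGate_mem (k := k + 1) (j := j) (by omega)

theorem extendPerm_succ_mem {k : ℕ} {π : Perm (Fin k → Bool)} (hπ : π ∈ segmentGroup k) :
    extendPerm _ (Fin.succ_injective k) π ∈ segmentGroup (k + 1) := by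
  suffices segmentGroup k ≤
      (segmentGroup (k + 1)).comap (extendPerm _ (Fin.succ_injective k)) from this hπ
  rw [segmentGroup, Subgroup.closure_le]
  rintro _ ⟨j, hj, rfl⟩
  rw [SetLike.mem_coe, Subgroup.mem_comap, segmentGate, extendPerm_cellGate]
  exact segmentGate_mem (k := k + 1) (j := j + 1) (by omega)

/-- All words of length `m + 1` with first letter `0` and last letter `1` lie in one class. -/
def SectorConnected (m : ℕ) : Prop :=
  ∀ x y : Fin (m + 1) → Bool, x 0 = false → x (Fin.last m) = true → y 0 = false →
    y (Fin.last m) = true → Cyc3Rel (segmentGroup (m + 1)) x y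

theorem SectorConnected.cyc3_mem {m : ℕ} (h : SectorConnected m) {x y z : Fin (m + 1) → Bool}
    (hx : x 0 = false) (hx' : x (Fin.last m) = true) (hy : y 0 = false)
    (hy' : y (Fin.last m) = true) (hz : z 0 = false) (hz' : z (Fin.last m) = true)
    (hxy : x ≠ y) (hxz : x ≠ z) (hyz : y ≠ z) : cyc3 x y z ∈ segmentGroup (m + 1) :=
  ((h x y hx hx' hy hy').hasCyc3 (h y z hy hy' hz hz') hxy hxz hyz).2.2.2

theorem eq_of_cyc3_apply_ne {α : Type*} [DecidableEq α] {a b c d : α} (h : cyc3 a b c d ≠ d) :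
    d = a ∨ d = b ∨ d = c := by
  by_contra! h'
  exact h (cyc3_apply_of_ne h'.1 h'.2.1 h'.2.2)

/-- The 3-cycle is a commutator of a 3-cycle `σ` on all cells but the last and a 3-cycle `τ` on all
cells but the first. Words moved by `τ` have letter 0 at cell 1 and letter 1 at the end; among the
words moved by `σ`, only `z` satisfies both. -/
theorem SectorConnected.hasCyc3_succ {q : ℕ} (h : SectorConnected (q + 4))
    {z v w : Fin (q + 6) → Bool} (hz0 : z 0 = false) (hz1 : z 1 = false)
    (hz2 : z (Fin.last (q + 4)).castSucc = true) (hz3 : z (Fin.last (q + 5)) = true)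
    (hv0 : v 0 = false) (hv1 : v 1 = true) (hv2 : v (Fin.last (q + 4)).castSucc = true)
    (hv3 : v (Fin.last (q + 5)) = true) (hw0 : w 0 = false) (hw1 : w 1 = false)
    (hw3 : w (Fin.last (q + 5)) = true) (hwz : w ≠ z) :
    HasCyc3 (segmentGroup (q + 6)) z v w := by
  have h_mod : 2 % (q + 5) = 2 := Nat.mod_eq_of_lt (by omega)
  have h2 : (2 : Fin (q + 5)) ≠ Fin.last (q + 4) := by
    simp [Fin.ext_iff, h_mod]
  have h1 : (1 : Fin (q + 5)) ≠ Fin.last (q + 4) := by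
    simp [Fin.ext_iff]
  have h20 : (2 : Fin (q + 5)) ≠ 0 := by simp [Fin.ext_iff, h_mod]
  have h10 : (1 : Fin (q + 5)) ≠ 0 := by simp
  have h12 : (1 : Fin (q + 5)) ≠ 2 := by simp [Fin.ext_iff, h_mod]
  have hc1 : (1 : Fin (q + 5)).castSucc = 1 := rfl
  have hs0 : (0 : Fin (q + 5)).succ = 1 := rfl
  obtain ⟨v', hv'v, hv'0, hv'1, hv'2⟩ : ∃ v' : Fin (q + 5) → Bool, v ∘ Fin.castSucc ≠ v' ∧
      v' 0 = false ∧ v' 1 = true ∧ v' (Fin.last (q + 4)) = true := by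
    -- The word `v'` only completes the 3-cycle and drops out of the commutator. Flipping cell 2
    -- leaves the prescribed letters at cell 1 and at both ends intact.
    refine ⟨Function.update (v ∘ Fin.castSucc) 2 (!v (Fin.castSucc 2)), fun h => ?_, ?_, ?_, ?_⟩
    · have := congrFun h 2
      simp at this
    · simpa [h20.symm] using hv0
    · simpa [h12] using hv1
    · simpa [h2.symm] using hv2
  obtain ⟨w', hw'w, hw'z, hw'0, hw'2⟩ : ∃ w' : Fin (q + 5) → Bool, w ∘ Fin.succ ≠ w' ∧
      z ∘ Fin.succ ≠ w' ∧ w' 0 = false ∧ w' (Fin.last (q + 4)) = true := by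
    have key : ∀ i : Fin (q + 5), i ≠ 0 → i ≠ Fin.last (q + 4) →
        z ∘ Fin.succ ≠ Function.update (w ∘ Fin.succ) i (!w (Fin.succ i)) →
        ∃ w' : Fin (q + 5) → Bool, w ∘ Fin.succ ≠ w' ∧
          z ∘ Fin.succ ≠ w' ∧ w' 0 = false ∧ w' (Fin.last (q + 4)) = true := by
      intro i hi0 hi1 hi
      refine ⟨_, fun h => ?_, hi, ?_, ?_⟩
      · have := congrFun h i
        simp at this
      · simpa [hi0.symm] using hw1
      · simpa [hi1.symm] using hw3
    -- The flips of `w` at cells 1 and 2 differ, so at least one of them is not `z`.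
    by_cases h' : z ∘ Fin.succ = Function.update (w ∘ Fin.succ) 1 (!w (Fin.succ 1))
    · refine key 2 h20 h2 fun h'' => ?_
      have := congrFun (h'.symm.trans h'') 1
      simp [h12] at this
    · exact key 1 h10 h1 h'
  have hzw : z ∘ Fin.succ ≠ w ∘ Fin.succ := fun h' => hwz <| by
    ext i
    refine Fin.cases (by rw [hz0, hw0]) (fun i => (congrFun h' i).symm) i
  have hzv : z ∘ Fin.castSucc ≠ v ∘ Fin.castSucc := fun h' => by
    have := congrFun h' 1
    simp [hc1, hz1, hv1] at this
  have hzv' : z ∘ Fin.castSucc ≠ v' := fun h' => by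
    have := congrFun h' 1
    simp [hc1, hz1, hv'1] at this
  have hσ0 := h.cyc3_mem (x := z ∘ Fin.castSucc) (y := v ∘ Fin.castSucc) (z := v')
    hz0 hz2 hv0 hv2 hv'0 hv'2 hzv hzv' hv'v
  have hτ0 := h.cyc3_mem (x := z ∘ Fin.succ) (y := w ∘ Fin.succ) (z := w')
    hz1 hz3 hw1 hw3 hw'0 hw'2 hzw hw'z hw'w
  have hσ := extendPerm_castSucc_mem hσ0
  have hτ := extendPerm_succ_mem hτ0
  set σ := extendPerm _ (Fin.castSucc_injective _)
    (cyc3 (z ∘ Fin.castSucc) (v ∘ Fin.castSucc) v') with hσdef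
  set τ := extendPerm _ (Fin.succ_injective _) (cyc3 (z ∘ Fin.succ) (w ∘ Fin.succ) w') with hτdef
  have hσz : σ z = v := by
    refine extendPerm_eq _ (cyc3_apply_left hzv hzv') fun j => ?_
    refine Fin.lastCases (fun _ => by rw [hz3, hv3]) (fun i hi => absurd ⟨i, rfl⟩ hi) j
  have hτz : τ z = w := by
    refine extendPerm_eq _ (cyc3_apply_left hzw hw'z) fun j => ?_
    refine Fin.cases (fun _ => by rw [hz0, hw0]) (fun i hi => absurd ⟨i, rfl⟩ hi) j
  have hvz : v ≠ z := fun h' => hzv (by rw [h'])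
  have hvw : v ≠ w := fun h' => by simp [h', hw1] at hv1
  have hcomm := commutator_eq_cyc3 (σ := σ) (τ := τ) (z := z) (by rwa [hσz]) (by rwa [hτz])
    fun x hxσ hxτ => by
      have hx0 : x 1 = false ∧ x (Fin.last (q + 5)) = true := by
        rcases eq_of_cyc3_apply_ne (extendPerm_ne _ hxτ) with h' | h' | h'
        · exact ⟨(congrFun h' 0).trans hz1, (congrFun h' (Fin.last _)).trans hz3⟩
        · exact ⟨(congrFun h' 0).trans hw1, (congrFun h' (Fin.last _)).trans hw3⟩
        · exact ⟨(congrFun h' 0).trans hw'0, (congrFun h' (Fin.last _)).trans hw'2⟩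
      rcases eq_of_cyc3_apply_ne (extendPerm_ne _ hxσ) with h' | h' | h'
      · ext i
        refine Fin.lastCases (by rw [hx0.2, hz3]) (fun i => congrFun h' i) i
      · have := (congrFun h' 1).trans hv1
        simp [hc1, hx0.1] at this
      · have := (congrFun h' 1).trans hv'1
        simp [hc1, hx0.1] at this
  rw [hσz, hτz] at hcomm
  refine ⟨hvz.symm, hwz.symm, hvw, ?_⟩
  rw [← hcomm]
  exact mul_mem (mul_mem (mul_mem hσ hτ) (inv_mem hσ)) (inv_mem hτ)

/-- The commutators reach from z = 0…011 all words 00…1 and 01…11. Both `g₁` and `g₂` map `z` into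
its class and so preserve it; they bring in the remaining words 01…01 by flipping cell 1 when cell 2
is 0, and otherwise cell 2 first. -/
theorem SectorConnected.succ {q : ℕ} (h : SectorConnected (q + 4)) : SectorConnected (q + 5) := by
  have h_mod : 2 % (q + 6) = 2 := Nat.mod_eq_of_lt (by omega)
  have h10 : (1 : Fin (q + 6)) ≠ 0 := by simp
  have h20 : (2 : Fin (q + 6)) ≠ 0 := by simp [Fin.ext_iff, h_mod]
  have h21 : (2 : Fin (q + 6)) ≠ 1 := by simp [Fin.ext_iff, h_mod]
  have h1c : (1 : Fin (q + 6)) ≠ (Fin.last (q + 4)).castSucc := by simp [Fin.ext_iff]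
  have h2c : (2 : Fin (q + 6)) ≠ (Fin.last (q + 4)).castSucc := by simp [Fin.ext_iff, h_mod]
  have h1l : (1 : Fin (q + 6)) ≠ Fin.last (q + 5) := by simp [Fin.ext_iff]
  have h2l : (2 : Fin (q + 6)) ≠ Fin.last (q + 5) := by simp [Fin.ext_iff, h_mod]
  set K := segmentGroup (q + 6)
  let g₁ : Perm (Fin (q + 6) → Bool) := segmentGate 0 (by omega)
  let g₂ : Perm (Fin (q + 6) → Bool) := segmentGate 1 (by omega)
  have hg₁ : g₁ ∈ K := segmentGate_mem _
  have hg₂ : g₂ ∈ K := segmentGate_mem _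
  have g₁_self : ∀ x, g₁ x 1 = xor (x 1) (x 0 || !x 2) := fun x => cellGate_apply_self _ _ _ _ _ x
  have g₂_self : ∀ x, g₂ x 2 = xor (x 2) (x 1 || !x 3) := fun x => cellGate_apply_self _ _ _ _ _ x
  have g₁_ne : ∀ x {i}, i ≠ 1 → g₁ x i = x i := fun x i hi => cellGate_apply_of_ne _ _ x hi
  have g₂_ne : ∀ x {i}, i ≠ 2 → g₂ x i = x i := fun x i hi => cellGate_apply_of_ne _ _ x hi
  let z : Fin (q + 6) → Bool := fun i => decide (i = (Fin.last (q + 4)).castSucc ∨ i = Fin.last _)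
  have hz0 : z 0 = false := by simp [z, Fin.ext_iff]
  have hz1 : z 1 = false := by simp [z, Fin.ext_iff]
  have hz2 : z 2 = false := by simp [z, Fin.ext_iff, h_mod]
  have hzc : z (Fin.last (q + 4)).castSucc = true := by simp [z]
  have hzl : z (Fin.last (q + 5)) = true := by simp [z]
  have hw : ∀ w : Fin (q + 6) → Bool, w 0 = false → w 1 = false → w (Fin.last _) = true →
      Cyc3Rel K z w := by
    intro w hw0 hw1 hwl
    by_cases hwz : w = z
    · exact hwz ▸ Cyc3Rel.refl K _
    refine (h.hasCyc3_succ hz0 hz1 hzc hzl (v := Function.update z 1 true) ?_ ?_ ?_ ?_ hw0 hw1 hwl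
      hwz).rel_right <;> simp [h10.symm, h1c.symm, h1l.symm, hz0, hzc, hzl]
  have hv : ∀ v : Fin (q + 6) → Bool, v 0 = false → v 1 = true →
      v (Fin.last (q + 4)).castSucc = true → v (Fin.last _) = true → Cyc3Rel K z v := by
    intro v hv0 hv1 hvc hvl
    refine (h.hasCyc3_succ hz0 hz1 hzc hzl hv0 hv1 hvc hvl (w := Function.update z 2 true)
      ?_ ?_ ?_ ?_).rel_left
    · simp [h20.symm, hz0]
    · simp [h21.symm, hz1]
    · simp [h2l.symm, hzl]
    · intro h'
      have := congrFun h' 2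
      simp [hz2] at this
  have hg₁z : Cyc3Rel K z (g₁ z) := by
    refine hv _ ?_ ?_ ?_ ?_
    · rw [g₁_ne _ h10.symm, hz0]
    · rw [g₁_self, hz0, hz1, hz2]; rfl
    · rw [g₁_ne _ h1c.symm, hzc]
    · rw [g₁_ne _ h1l.symm, hzl]
  have hg₂z : Cyc3Rel K z (g₂ z) := by
    refine hw _ ?_ ?_ ?_
    · rw [g₂_ne _ h20.symm, hz0]
    · rw [g₂_ne _ h21.symm, hz1]
    · rw [g₂_ne _ h2l.symm, hzl]
  have hx₁ : ∀ x : Fin (q + 6) → Bool, x 0 = false → x 2 = false → x (Fin.last _) = true →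
      Cyc3Rel K z x := by
    intro x hx0 hx2 hxl
    cases hx1 : x 1 with
    | false => exact hw x hx0 hx1 hxl
    | true =>
      have := Cyc3Rel.apply_of_apply hg₁ (.refl K z) hg₁z (hw (g₁ x) ?_ ?_ ?_)
      · rwa [show g₁ (g₁ x) = x from cellGate_cellGate _ _ x] at this
      · rw [g₁_ne _ h10.symm, hx0]
      · rw [g₁_self, hx0, hx1, hx2]; rfl
      · rw [g₁_ne _ h1l.symm, hxl]
  have hx₂ : ∀ x : Fin (q + 6) → Bool, x 0 = false → x (Fin.last _) = true → Cyc3Rel K z x := by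
    intro x hx0 hxl
    cases hx1 : x 1 with
    | false => exact hw x hx0 hx1 hxl
    | true =>
      cases hx2 : x 2 with
      | false => exact hx₁ x hx0 hx2 hxl
      | true =>
        have := Cyc3Rel.apply_of_apply hg₂ (.refl K z) hg₂z (hx₁ (g₂ x) ?_ ?_ ?_)
        · rwa [show g₂ (g₂ x) = x from cellGate_cellGate _ _ x] at this
        · rw [g₂_ne _ h20.symm, hx0]
        · rw [g₂_self, hx1, hx2]; rfl
        · rw [g₂_ne _ h2l.symm, hxl]
  exact fun x y hx0 hxl hy0 hyl => (hx₂ x hx0 hxl).symm.trans (hx₂ y hy0 hyl)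

end Segments

/-! ### Segments of four and five cells: the base case -/

theorem exists_eq_vec4 (x : Fin 4 → Bool) : ∃ a b c d, x = ![a, b, c, d] :=
  ⟨x 0, x 1, x 2, x 3, by ext i; fin_cases i <;> rfl⟩

theorem exists_eq_vec5 (x : Fin 5 → Bool) : ∃ a b c d e, x = ![a, b, c, d, e] :=
  ⟨x 0, x 1, x 2, x 3, x 4, by ext i; fin_cases i <;> rfl⟩

section SmallSegments

variable (a b c d e : Bool)

theorem segmentGate_vec4_zero :
    segmentGate 0 (by omega) ![a, b, c, d] = ![a, xor b (a || !c), c, d] := by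
  ext i; fin_cases i <;> rfl

theorem segmentGate_vec4_one :
    segmentGate 1 (by omega) ![a, b, c, d] = ![a, b, xor c (b || !d), d] := by
  ext i; fin_cases i <;> rfl

theorem segmentGate_vec5_zero :
    segmentGate 0 (by omega) ![a, b, c, d, e] = ![a, xor b (a || !c), c, d, e] := by
  ext i; fin_cases i <;> rfl

theorem segmentGate_vec5_one :
    segmentGate 1 (by omega) ![a, b, c, d, e] = ![a, b, xor c (b || !d), d, e] := by
  ext i; fin_cases i <;> rfl

theorem segmentGate_vec5_two :
    segmentGate 2 (by omega) ![a, b, c, d, e] = ![a, b, c, xor d (c || !e), e] := by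
  ext i; fin_cases i <;> rfl

end SmallSegments

/-- The product of the two gates fixes the end letters. For ends 0 and 1 it is a 3-cycle on the
inner letters; for the other ends its order divides 4. The fourth power keeps exactly the 3-cycle.
-/
theorem cyc3_mem_segmentGroup_four :
    cyc3 ![false, false, false, true] ![false, true, false, true] ![false, true, true, true] ∈
      segmentGroup 4 := by
  have h : (segmentGate (k := 4) 0 (by omega) * segmentGate 1 (by omega)) ^ 4 =
      cyc3 ![false, false, false, true] ![false, true, false, true] ![false, true, true, true] := by
    ext1 x
    obtain ⟨a, b, c, d, rfl⟩ := exists_eq_vec4 x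
    simp only [pow_succ, pow_zero, one_mul, Perm.mul_apply, cyc3, swap_apply_def]
    cases a <;> cases b <;> cases c <;> cases d <;>
      simp [segmentGate_vec4_zero, segmentGate_vec4_one]
  rw [← h]
  exact pow_mem (mul_mem (segmentGate_mem _) (segmentGate_mem _)) 4

/-- The two copies `A` and `B` of the 3-cycle, on the first and on the last four cells, have
disjoint supports. Conjugating `A` by `h` creates exactly one common moved word, so that the
commutator becomes a 3-cycle. -/
theorem hasCyc3_segmentGroup_five :
    HasCyc3 (segmentGroup 5) ![false, false, false, false, true] ![false, true, false, true, true]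
      ![false, false, true, false, true] := by
  have hmem := cyc3_mem_segmentGroup_four
  set ρ := cyc3 ![false, false, false, true] ![false, true, false, true] ![false, true, true, true]
    with hρ
  let h : Perm (Fin 5 → Bool) :=
    segmentGate 0 (by omega) * (segmentGate 1 (by omega) * segmentGate 2 (by omega))
  have hh : h ∈ segmentGroup 5 :=
    mul_mem (segmentGate_mem _) (mul_mem (segmentGate_mem _) (segmentGate_mem _))
  have h_inv : ∀ x, h⁻¹ x =
      segmentGate 2 (by omega) (segmentGate 1 (by omega) (segmentGate 0 (by omega) x)) :=
    fun x => rfl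
  have hL := extendPerm_castSucc_mem hmem
  have hR := extendPerm_succ_mem hmem
  set A := extendPerm _ (Fin.castSucc_injective 4) ρ with hA
  set B := extendPerm _ (Fin.succ_injective 4) ρ with hB
  have hσz : (h * A * h⁻¹) ![false, false, false, false, true] =
      ![false, true, false, true, true] := by
    have : h⁻¹ ![false, false, false, false, true] = ![false, true, true, true, true] := by
      simp [h_inv, segmentGate_vec5_zero, segmentGate_vec5_one, segmentGate_vec5_two]
    have h' : A ![false, true, true, true, true] = ![false, false, false, true, true] := by
      refine extendPerm_eq _ ?_ ?_
      · have : (![false, true, true, true, true] : Fin 5 → Bool) ∘ Fin.castSucc =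
          ![false, true, true, true] := by decide
        rw [this, hρ, cyc3_apply_right]; decide
      · decide
    rw [Perm.mul_apply, Perm.mul_apply, this, h']
    simp [h, segmentGate_vec5_zero, segmentGate_vec5_one, segmentGate_vec5_two]
  have hτz : B ![false, false, false, false, true] = ![false, false, true, false, true] := by
    refine extendPerm_eq _ ?_ ?_
    · have : (![false, false, false, false, true] : Fin 5 → Bool) ∘ Fin.succ =
        ![false, false, false, true] := by decide
      rw [this, hρ, cyc3_apply_left] <;> decide
    · decide
  have hcomm := commutator_eq_cyc3 (σ := h * A * h⁻¹) (τ := B)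
    (z := ![false, false, false, false, true]) (by rw [hσz]; decide) (by rw [hτz]; decide)
    fun x hx hx' => by
      have h1 : A (h⁻¹ x) ≠ h⁻¹ x := fun h' => hx (by
        rw [Perm.mul_apply, Perm.mul_apply, h']; exact h.apply_symm_apply x)
      have h2 := eq_of_cyc3_apply_ne (extendPerm_ne _ h1)
      have h3 := eq_of_cyc3_apply_ne (extendPerm_ne _ hx')
      revert h2 h3
      rw [h_inv]
      clear hx hx' h1
      obtain ⟨a, b, c, d, e, rfl⟩ := exists_eq_vec5 x
      rw [segmentGate_vec5_zero, segmentGate_vec5_one, segmentGate_vec5_two]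
      revert a b c d e
      decide
  rw [hσz, hτz] at hcomm
  refine ⟨by decide, by decide, by decide, ?_⟩
  rw [← hcomm]
  exact mul_mem (mul_mem (mul_mem (mul_mem (mul_mem hh hL) (inv_mem hh)) hR)
    (inv_mem (mul_mem (mul_mem hh hL) (inv_mem hh)))) (inv_mem hR)

/-- Each of the three gates sends one of the words 00001 and 00101 to a word of their common class,
hence preserves that class; applying the gates then reaches all eight words. -/
theorem sectorConnected_four : SectorConnected 4 := by
  have h₁ := hasCyc3_segmentGroup_five.rel_left
  have h₂ := hasCyc3_segmentGroup_five.rel_right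
  set z : Fin 5 → Bool := ![false, false, false, false, true] with hz
  have hz₀ := Cyc3Rel.refl (segmentGroup 5) z
  have hg₁ : ∀ b c d, Cyc3Rel (segmentGroup 5) z ![false, b, c, d, true] →
      Cyc3Rel (segmentGroup 5) z ![false, xor b (false || !c), c, d, true] := fun b c d h => by
    rw [← segmentGate_vec5_zero]
    refine Cyc3Rel.apply_of_apply (segmentGate_mem _) h₂ ?_ h
    rw [segmentGate_vec5_zero]
    exact h₂
  have hg₂ : ∀ b c d, Cyc3Rel (segmentGroup 5) z ![false, b, c, d, true] →
      Cyc3Rel (segmentGroup 5) z ![false, b, xor c (b || !d), d, true] := fun b c d h => by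
    rw [← segmentGate_vec5_one]
    refine Cyc3Rel.apply_of_apply (segmentGate_mem _) hz₀ ?_ h
    rw [hz, segmentGate_vec5_one]
    exact h₂
  have hg₃ : ∀ b c d, Cyc3Rel (segmentGroup 5) z ![false, b, c, d, true] →
      Cyc3Rel (segmentGroup 5) z ![false, b, c, xor d (c || !true), true] := fun b c d h => by
    rw [← segmentGate_vec5_two]
    refine Cyc3Rel.apply_of_apply (segmentGate_mem _) hz₀ ?_ h
    rw [hz, segmentGate_vec5_two]
    exact hz₀
  have h100 := hg₁ _ _ _ hz₀
  have h001 := hg₁ _ _ _ h₁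
  have h111 := hg₂ _ _ _ h₁
  have h011 := hg₃ _ _ _ h₂
  have h110 := hg₃ _ _ _ h111
  have key : ∀ x : Fin 5 → Bool, x 0 = false → x (Fin.last 4) = true →
      Cyc3Rel (segmentGroup 5) z x := by
    intro x hx0 hx4
    obtain ⟨a, b, c, d, e, rfl⟩ := exists_eq_vec5 x
    obtain rfl : a = false := hx0
    obtain rfl : e = true := hx4
    cases b <;> cases c <;> cases d <;> assumption
  exact fun x y hx hx' hy hy' => (key x hx hx').symm.trans (key y hy hy')

theorem sectorConnected {m : ℕ} (hm : 4 ≤ m) : SectorConnected m := by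
  induction m, hm using Nat.le_induction with
  | base => exact sectorConnected_four
  | succ m hm ih =>
    obtain ⟨q, rfl⟩ := Nat.exists_eq_add_of_le' hm
    exact ih.succ

/-! ### From segments to the cycle -/

section Ring

theorem ringShift_apply {n : ℕ} (x : ZMod n → Bool) (i : ZMod n) :
    ringShift n x i = x (i + 1) := rfl

theorem ringShift_pow_apply {n : ℕ} (k : ℕ) (x : ZMod n → Bool) (i : ZMod n) :
    (ringShift n ^ k) x i = x (i + k) := by
  induction k generalizing i with
  | zero => simp
  | succ k ih =>
    rw [pow_succ', Perm.mul_apply, ringShift_apply, ih]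
    congr 1
    push_cast
    ring

/-- The group generated by the gate `e⁵⁷` and the shift. -/
def ringGroup (n : ℕ) (hn : 2 ≤ n) : Subgroup (Perm (ZMod n → Bool)) :=
  Subgroup.closure {ringGate n 57 hn isCellReversible_57, ringShift n}

theorem ringGate_mem {n : ℕ} (hn : 2 ≤ n) :
    ringGate n 57 hn isCellReversible_57 ∈ ringGroup n hn :=
  Subgroup.subset_closure (by simp)

theorem ringShift_mem {n : ℕ} (hn : 2 ≤ n) : ringShift n ∈ ringGroup n hn :=
  Subgroup.subset_closure (by simp)

theorem ringGate_apply_of_ne {n N : ℕ} (hn : 2 ≤ n) (hN : IsCellReversible N)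
    (x : ZMod n → Bool) {i : ZMod n} (hi : i ≠ 0) : ringGate n N hn hN x i = x i :=
  Function.update_of_ne hi _ _

theorem ringGate_apply_zero {n N : ℕ} (hn : 2 ≤ n) (hN : IsCellReversible N)
    (x : ZMod n → Bool) : ringGate n N hn hN x 0 = wolframRule N (x (-1)) (x 0) (x 1) :=
  Function.update_self _ _ _

theorem ringGate_ringGate {n N : ℕ} (hn : 2 ≤ n) (hN : IsCellReversible N)
    (x : ZMod n → Bool) : ringGate n N hn hN (ringGate n N hn hN x) = x :=
  ringGateFun_involutive hn hN x

theorem wolframRule_57 (l c r : Bool) : wolframRule 57 l c r = xor c (l || !r) := by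
  revert l c r; decide

theorem cellGate_mem_ringGroup {n : ℕ} [NeZero n] (hn : 2 ≤ n) {l c r : ZMod n} (hl : l ≠ c)
    (hr : r ≠ c) (hlc : l + 1 = c) (hcr : c + 1 = r) :
    cellGate l c r hl hr ∈ ringGroup n hn := by
  obtain rfl : l = c - 1 := eq_sub_of_add_eq hlc
  subst hcr
  have hs := pow_mem (ringShift_mem hn) c.val
  have : ringShift n ^ c.val * cellGate (c - 1) c (c + 1) hl hr =
      ringGate n 57 hn isCellReversible_57 * ringShift n ^ c.val := by
    ext1 x
    ext i
    rw [Perm.mul_apply, Perm.mul_apply, ringShift_pow_apply, ZMod.natCast_zmod_val]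
    by_cases hi : i = 0
    · subst hi
      rw [ringGate_apply_zero, wolframRule_57, zero_add, cellGate_apply_self]
      simp only [ringShift_pow_apply, ZMod.natCast_zmod_val]
      rw [zero_add, neg_add_eq_sub, add_comm 1 c]
    · rw [ringGate_apply_of_ne hn _ _ hi, cellGate_apply_of_ne _ _ _ (by simpa using hi),
        ringShift_pow_apply, ZMod.natCast_zmod_val]
  rw [eq_inv_mul_of_mul_eq this]
  exact mul_mem (inv_mem hs) (mul_mem (ringGate_mem hn) hs)

/-- Words on the segment `{0, …, n - 1}` as words on the cycle. -/
def segmentEquiv (n : ℕ) [NeZero n] : (Fin n → Bool) ≃ (ZMod n → Bool) :=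
  (ZMod.finEquiv n).toEquiv.arrowCongr (Equiv.refl Bool)

theorem segmentEquiv_symm_apply {n : ℕ} [NeZero n] (x : ZMod n → Bool) (i : Fin n) :
    (segmentEquiv n).symm x i = x (ZMod.finEquiv n i) := by
  simp [segmentEquiv, Equiv.arrowCongr]

theorem finEquiv_add_one {n : ℕ} [NeZero n] {j : ℕ} (hj : j + 1 < n) :
    ZMod.finEquiv n ⟨j, by omega⟩ + 1 = ZMod.finEquiv n ⟨j + 1, hj⟩ := by
  rw [← map_one (ZMod.finEquiv n), ← map_add]
  congr 1
  ext
  rw [Fin.val_add, Fin.val_one', Nat.add_mod_mod, Nat.mod_eq_of_lt hj]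

theorem permCongr_mem_ringGroup {n : ℕ} [NeZero n] (hn : 2 ≤ n) {π : Perm (Fin n → Bool)}
    (hπ : π ∈ segmentGroup n) : (segmentEquiv n).permCongr π ∈ ringGroup n hn := by
  suffices segmentGroup n ≤
      (ringGroup n hn).comap (segmentEquiv n).permCongrHom.toMonoidHom from this hπ
  rw [segmentGroup, Subgroup.closure_le]
  rintro _ ⟨j, hj, rfl⟩
  change (segmentEquiv n).permCongr _ ∈ ringGroup n hn
  rw [segmentEquiv, segmentGate, permCongr_cellGate]
  exact cellGate_mem_ringGroup hn _ _ (finEquiv_add_one _) (finEquiv_add_one _)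

theorem Cyc3Rel.ring {n : ℕ} [NeZero n] (hn : 2 ≤ n) {x y : Fin n → Bool}
    (h : Cyc3Rel (segmentGroup n) x y) :
    Cyc3Rel (ringGroup n hn) (segmentEquiv n x) (segmentEquiv n y) :=
  h.map _ fun _ => permCongr_mem_ringGroup hn

/-- On a cycle of length at least 5, two words with `10` at the same place lie in one class. -/
theorem cyc3Rel_of_sector {n : ℕ} [NeZero n] (hn : 5 ≤ n) (i : ZMod n) {x y : ZMod n → Bool}
    (hx : x (i - 1) = true) (hx' : x i = false) (hy : y (i - 1) = true) (hy' : y i = false) :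
    Cyc3Rel (ringGroup n (by omega)) x y := by
  have base : ∀ x y : ZMod n → Bool, x (-1) = true → x 0 = false → y (-1) = true → y 0 = false →
      Cyc3Rel (ringGroup n (by omega)) x y := by
    intro x y hx hx' hy hy'
    obtain ⟨m, rfl⟩ := Nat.exists_eq_add_of_le' (show 1 ≤ n by omega)
    have hl : ZMod.finEquiv (m + 1) (Fin.last m) = -1 := by
      rw [eq_neg_iff_add_eq_zero, ← map_one (ZMod.finEquiv (m + 1)), ← map_add, Fin.last_add_one,
        map_zero]
    have := ((sectorConnected (show 4 ≤ m by omega)) ((segmentEquiv (m + 1)).symm x)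
      ((segmentEquiv (m + 1)).symm y) (by rwa [segmentEquiv_symm_apply, map_zero])
      (by rwa [segmentEquiv_symm_apply, hl]) (by rwa [segmentEquiv_symm_apply, map_zero])
      (by rwa [segmentEquiv_symm_apply, hl])).ring (by omega)
    simpa using this
  -- The shift by `i` moves the cut between `i - 1` and `i` to the one between `-1` and `0`.
  have hs := pow_mem (ringShift_mem (n := n) (by omega)) i.val
  have := base ((ringShift n ^ i.val) x) ((ringShift n ^ i.val) y)
  simp only [ringShift_pow_apply, ZMod.natCast_zmod_val, zero_add, neg_add_eq_sub] at this
  have := (this hx hx' hy hy').apply (inv_mem hs)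
  rwa [← Perm.mul_apply, ← Perm.mul_apply, inv_mul_cancel, Perm.one_apply, Perm.one_apply] at this

theorem ZMod.natCast_ne_zero_of_lt {n k : ℕ} (hk : k ≠ 0) (hkn : k < n) : (k : ZMod n) ≠ 0 :=
  fun h => hkn.not_ge (Nat.le_of_dvd (Nat.pos_of_ne_zero hk) ((ZMod.natCast_eq_zero_iff k n).mp h))

theorem cyc3Rel_of_sectors {n : ℕ} [NeZero n] (hn : 5 ≤ n) (i j : ZMod n) {x y : ZMod n → Bool}
    (hx : x (i - 1) = true) (hx' : x i = false) (hy : y (j - 1) = true) (hy' : y j = false) :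
    Cyc3Rel (ringGroup n (by omega)) x y := by
  let S : ZMod n → Set (ZMod n → Bool) := fun i => {x | x (i - 1) = true ∧ x i = false}
  let Q : ZMod n → ZMod n → Prop := fun i j =>
    ∀ x ∈ S i, ∀ y ∈ S j, Cyc3Rel (ringGroup n (by omega)) x y
  have h1 : (1 : ZMod n) ≠ 0 := by
    exact_mod_cast ZMod.natCast_ne_zero_of_lt (n := n) (k := 1) (by omega) (by omega)
  have h2 : (2 : ZMod n) ≠ 0 := by
    exact_mod_cast ZMod.natCast_ne_zero_of_lt (n := n) (k := 2) (by omega) (by omega)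
  have h3 : (3 : ZMod n) ≠ 0 := by
    exact_mod_cast ZMod.natCast_ne_zero_of_lt (n := n) (k := 3) (by omega) (by omega)
  have h4 : (4 : ZMod n) ≠ 0 := by
    exact_mod_cast ZMod.natCast_ne_zero_of_lt (n := n) (k := 4) (by omega) (by omega)
  have hself : ∀ i, Q i i := fun i x hx y hy =>
    cyc3Rel_of_sector hn i hx.1 hx.2 hy.1 hy.2
  have hadj : ∀ i d, d - 1 ≠ 0 → d + 1 ≠ 0 → Q i (i + d) := by
    intro i d hd hd' x hx y hy
    -- The word with zeros exactly at `i` and `i + d` lies in both sectors, provided that the two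
    -- cells are not neighbours.
    let w : ZMod n → Bool := fun t => !decide (t = i ∨ t = i + d)
    have hi : i - 1 ≠ i := fun h => h1 (by linear_combination -h)
    have hi' : i - 1 ≠ i + d := fun h => hd' (by linear_combination -h)
    have hj : i + d - 1 ≠ i := fun h => hd (by linear_combination h)
    have hj' : i + d - 1 ≠ i + d := fun h => h1 (by linear_combination -h)
    exact (hself i x hx w ⟨by simp [w, hi, hi'], by simp [w]⟩).trans
      (hself (i + d) w ⟨by simp [w, hj, hj'], by simp [w]⟩ y hy)
  have htrans : ∀ i j k, Q i j → Q j k → Q i k := by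
    intro i j k hij hjk x hx y hy
    -- Transitivity needs a word in the middle sector.
    have : (fun t => !decide (t = j)) ∈ S j :=
      ⟨by simp [sub_eq_self, h1], by simp⟩
    exact (hij x hx _ this).trans (hjk _ this y hy)
  have hsymm : ∀ i j, Q i j → Q j i := fun i j h x hx y hy => (h y hy x hx).symm
  -- Adjacent sectors are disjoint, so the chain passes through `i + 3`, which for n ≥ 5 is adjacent
  -- to neither `i` nor `i + 1`.
  have hsucc : ∀ i, Q i (i + 1) := by
    intro i
    refine htrans i (i + 3) _ (hadj i 3 ?_ ?_) (hsymm _ _ ?_)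
    · intro h; exact h2 (by linear_combination h)
    · intro h; exact h4 (by linear_combination h)
    · have := hadj (i + 1) 2 (fun h => h1 (by linear_combination h))
        (fun h => h3 (by linear_combination h))
      rwa [show i + 1 + 2 = i + 3 by ring] at this
  have hnat : ∀ k : ℕ, Q i (i + k) := by
    intro k
    induction k with
    | zero => simpa using hself i
    | succ k ih =>
      refine htrans _ _ _ ih ?_
      rw [Nat.cast_succ, ← add_assoc]
      exact hsucc _
  have := hnat (j - i).val
  rw [ZMod.natCast_zmod_val, add_sub_cancel] at this
  exact this x ⟨hx, hx'⟩ y ⟨hy, hy'⟩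

/-- Without a factor 10, the letter 1 would propagate from `a` around the whole cycle. -/
theorem exists_sector {n : ℕ} [NeZero n] {x : ZMod n → Bool} {a b : ZMod n} (ha : x a = true)
    (hb : x b = false) : ∃ i, x (i - 1) = true ∧ x i = false := by
  by_contra! h
  have key : ∀ k : ℕ, x (a + k) = true := by
    intro k
    induction k with
    | zero => simpa using ha
    | succ k ih =>
      have := h (a + k + 1) (by simpa using ih)
      rw [Nat.cast_succ, ← add_assoc]
      simpa using this
  have := key (b - a).val
  rw [ZMod.natCast_zmod_val, add_sub_cancel, hb] at this
  exact Bool.false_ne_true this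

theorem cyc3Rel_ringGroup {n : ℕ} [NeZero n] (hn : 5 ≤ n) (x y : ZMod n → Bool) :
    Cyc3Rel (ringGroup n (by omega)) x y := by
  have h1 : (1 : ZMod n) ≠ 0 := by
    exact_mod_cast ZMod.natCast_ne_zero_of_lt (n := n) (k := 1) (by omega) (by omega)
  have h2 : (2 : ZMod n) ≠ 0 := by
    exact_mod_cast ZMod.natCast_ne_zero_of_lt (n := n) (k := 2) (by omega) (by omega)
  let w : ZMod n → Bool := fun t => decide (t = 1)
  have hw : w (2 - 1) = true := by simp [w]; norm_num
  have hw' : w 2 = false := by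
    simp only [w, decide_eq_false_iff_not]
    intro h; exact h1 (by linear_combination h)
  set e := ringGate n 57 (by omega) isCellReversible_57 with he
  have hne : ∀ x : ZMod n → Bool, ∀ a b, x a = true → x b = false →
      Cyc3Rel (ringGroup n (by omega)) w x := by
    intro x a b ha hb
    obtain ⟨i, hi, hi'⟩ := exists_sector ha hb
    exact cyc3Rel_of_sectors hn 2 i hw hw' hi hi'
  -- The gate changes only cell 0, so `e w` keeps the factor 10 of `w` at cells 1 and 2. Hence `e`
  -- preserves the class of `w`.
  have hew : Cyc3Rel (ringGroup n (by omega)) w (e w) := by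
    refine hne _ (2 - 1) 2 ?_ ?_
    · rw [he, ringGate_apply_of_ne _ _ _ (fun h => h1 (by linear_combination h)), hw]
    · rw [he, ringGate_apply_of_ne _ _ _ h2, hw']
  have hx : ∀ x, Cyc3Rel (ringGroup n (by omega)) w x := by
    intro x
    -- If the three letters agree, as in a constant word, the gate flips cell 0 and makes it differ
    -- from cell 1; otherwise `x` is already nonconstant.
    by_cases hc : x 1 = x 0 ∧ x (-1) = x 0
    · have h0 : e x 0 = !x 0 := by
        rw [he, ringGate_apply_zero, wolframRule_57, hc.1, hc.2]
        simp
      have h1' : e x 1 = x 0 := by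
        rw [he, ringGate_apply_of_ne _ _ _ h1, hc.1]
      have : Cyc3Rel (ringGroup n (by omega)) w (e x) := by
        cases hx0 : x 0 with
        | false => exact hne _ 0 1 (by rw [h0, hx0]; rfl) (by rw [h1', hx0])
        | true => exact hne _ 1 0 (by rw [h1', hx0]) (by rw [h0, hx0]; rfl)
      have := Cyc3Rel.apply_of_apply (ringGate_mem (by omega)) (.refl _ w) hew this
      rwa [he, ringGate_ringGate] at this
    · have key : ∀ i, x i ≠ x 0 → Cyc3Rel (ringGroup n (by omega)) w x := by
        intro i hi
        cases hx0 : x 0 with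
        | false => exact hne x i 0 (by simpa [hx0] using hi) hx0
        | true => exact hne x 0 i hx0 (by simpa [hx0] using hi)
      by_cases h : x 1 = x 0
      · exact key (-1) fun h' => hc ⟨h, h'⟩
      · exact key 1 h
  exact (hx x).symm.trans (hx y)

end Ring

/-! ### Parity of the generators -/

section Sign

variable {ι : Type*}

/-- The permutation of `{0,1}^ι` which flips the cell `i`. -/
def flipCell [DecidableEq ι] (i : ι) : Perm (ι → Bool) :=
  Function.Involutive.toPerm (fun x => Function.update x i (!x i)) fun x => by simp

theorem flipCell_apply [DecidableEq ι] (i : ι) (x : ι → Bool) :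
    flipCell i x = Function.update x i (!x i) := rfl

/-- A permutation of words which ignores one of the cells is even. -/
theorem sign_eq_one_of_ignores [DecidableEq ι] [Fintype ι] (i : ι) (e : Perm (ι → Bool)) (h : ∀ x, e x i = x i)
    (h' : ∀ x, e (flipCell i x) = flipCell i (e x)) : Perm.sign e = 1 := by
  have hinv : ∀ x, e.symm x i = x i := fun x => by
    rw [← h (e.symm x), Equiv.apply_symm_apply]
  -- `a` is `e` on the words with letter 1 at `i`. Its conjugate by the flip of `i` is `e` on the
  -- other half, and both factors have the same sign.
  let a : Perm (ι → Bool) :=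
    { toFun := fun x => if x i then e x else x
      invFun := fun x => if x i then e.symm x else x
      left_inv := fun x => by
        cases hx : x i <;> simp [hx, h]
      right_inv := fun x => by
        cases hx : x i <;> simp [hx, hinv] }
  have ha : ∀ x, a x = if x i then e x else x := fun _ => rfl
  have hf : ∀ x, flipCell i (flipCell i x) = x := (flipCell i).left_inv
  have : e = a * (flipCell i * a * (flipCell i)⁻¹) := by
    ext1 x
    rw [Perm.mul_apply, Perm.mul_apply, Perm.mul_apply, show (flipCell i)⁻¹ = flipCell i from rfl,
      ha (flipCell i x)]
    cases hx : x i with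
    | false =>
      have : flipCell i x i = true := by simp [flipCell_apply, hx]
      rw [if_pos this, h', hf, ha, if_neg (by simp [h, hx])]
    | true =>
      have : ¬flipCell i x i = true := by simp [flipCell_apply, hx]
      rw [if_neg this, hf, ha, if_pos hx]
  rw [this]
  simp only [map_mul, map_inv]
  rw [mul_right_comm (Perm.sign (flipCell i)), mul_inv_cancel, one_mul, Int.units_mul_self]

/-- The action of permutations of the cells on words, by `(π, x) ↦ x ∘ π⁻¹`. -/
def permuteCells (ι : Type*) : Perm ι →* Perm (ι → Bool) where
  toFun π := π.arrowCongr (Equiv.refl Bool)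
  map_one' := rfl
  map_mul' _ _ := rfl

theorem permuteCells_apply (π : Perm ι) (x : ι → Bool) (i : ι) :
    permuteCells ι π x i = x (π.symm i) := rfl

/-- A transposition of two cells ignores any third cell. -/
theorem sign_permuteCells [DecidableEq ι] [Fintype ι] (h : 3 ≤ Fintype.card ι) (π : Perm ι) :
    Perm.sign (permuteCells ι π) = 1 := by
  induction π using Perm.swap_induction_on with
  | one => simp
  | swap_mul f a b hab ih =>
    rw [map_mul, map_mul, ih, mul_one]
    obtain ⟨i, hi⟩ : ∃ i, i ∉ ({a, b} : Finset ι) := by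
      by_contra! h'
      have := Finset.card_le_card (show Finset.univ ⊆ ({a, b} : Finset ι) from fun i _ => h' i)
      have := Finset.card_le_two (a := a) (b := b)
      rw [Finset.card_univ] at *
      omega
    simp only [Finset.mem_insert, Finset.mem_singleton, not_or] at hi
    refine sign_eq_one_of_ignores i _ (fun x => ?_) (fun x => ?_)
    · rw [permuteCells_apply, symm_swap, swap_apply_of_ne_of_ne hi.1 hi.2]
    · ext j
      rw [permuteCells_apply, symm_swap, flipCell_apply, flipCell_apply]
      by_cases hj : j = i
      · subst hj
        simp [swap_apply_of_ne_of_ne hi.1 hi.2, permuteCells_apply]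
      · have : swap a b j ≠ i := fun h' => hj <| by
          rw [← swap_apply_of_ne_of_ne hi.1 hi.2] at h'
          exact (swap a b).injective h'
        rw [Function.update_of_ne this, Function.update_of_ne hj, permuteCells_apply, symm_swap]

end Sign

theorem sign_ringShift {n : ℕ} [NeZero n] (hn : 3 ≤ n) : Perm.sign (ringShift n) = 1 := by
  have : ringShift n = permuteCells (ZMod n) (Equiv.addRight (-1)) := by
    ext x i
    rw [permuteCells_apply, ringShift_apply]
    simp
  rw [this]
  exact sign_permuteCells (by rwa [ZMod.card]) _

/-- For n ≥ 4, cell 2 is distinct from -1, 0 and 1, so the gate ignores it. -/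
theorem sign_ringGate {n N : ℕ} [NeZero n] (hn : 4 ≤ n) (hN : IsCellReversible N) :
    Perm.sign (ringGate n N (by omega) hN) = 1 := by
  have h1 : (1 : ZMod n) ≠ 0 := by
    exact_mod_cast ZMod.natCast_ne_zero_of_lt (n := n) (k := 1) (by omega) (by omega)
  have h2 : (2 : ZMod n) ≠ 0 := by
    exact_mod_cast ZMod.natCast_ne_zero_of_lt (n := n) (k := 2) (by omega) (by omega)
  have h3 : (3 : ZMod n) ≠ 0 := by
    exact_mod_cast ZMod.natCast_ne_zero_of_lt (n := n) (k := 3) (by omega) (by omega)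
  have h12 : (1 : ZMod n) ≠ 2 := fun h => h1 (by linear_combination -h)
  have hm2 : (-1 : ZMod n) ≠ 2 := fun h => h3 (by linear_combination -h)
  refine sign_eq_one_of_ignores 2 _ (fun x => ringGate_apply_of_ne _ _ _ h2) fun x => ?_
  ext j
  by_cases hj : j = 0
  · subst hj
    rw [ringGate_apply_zero, flipCell_apply, flipCell_apply, Function.update_of_ne h12,
      Function.update_of_ne hm2, Function.update_of_ne h2.symm, Function.update_of_ne h2.symm,
      ringGate_apply_zero]
  · rw [ringGate_apply_of_ne _ _ _ hj, flipCell_apply, flipCell_apply]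
    by_cases hj2 : j = 2
    · subst hj2
      rw [Function.update_self, Function.update_self, ringGate_apply_of_ne _ _ _ hj]
    · rw [Function.update_of_ne hj2, Function.update_of_ne hj2, ringGate_apply_of_ne _ _ _ hj]

/-! ### The cycle of length 4 -/

section RingFour

/-- The word `abcd` on the cycle of length 4. -/
def ringWord4 (a b c d : Bool) : ZMod 4 → Bool := (![a, b, c, d] : Fin 4 → Bool)

theorem exists_eq_ringWord4 (x : ZMod 4 → Bool) : ∃ a b c d, x = ringWord4 a b c d :=
  exists_eq_vec4 x

variable (a b c d : Bool)

theorem ringShift_ringWord4 : ringShift 4 (ringWord4 a b c d) = ringWord4 b c d a := by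
  funext i
  change Fin 4 at i
  fin_cases i <;> rfl

theorem ringGate_ringWord4 : ringGate 4 57 (by omega) isCellReversible_57 (ringWord4 a b c d) =
    ringWord4 (xor a (d || !b)) b c d := by
  funext i
  change Fin 4 at i
  fin_cases i
  · exact (ringGate_apply_zero _ _ _).trans (wolframRule_57 _ _ _)
  · rfl
  · rfl
  · rfl

end RingFour

/-- The sector argument fails here, since both interior gates of the segment fix 0011. Instead, the
3-cycle on four cells starts a class containing 0101, and elements of the group mapping a word of
the class into it enlarge the class. -/
theorem cyc3Rel_ringGroup_four (x y : ZMod 4 → Bool) :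
    Cyc3Rel (ringGroup 4 (by omega)) x y := by
  let G := ringGroup 4 (by omega)
  have h₀ : HasCyc3 (segmentGroup 4) ![false, false, false, true] ![false, true, false, true]
    ![false, true, true, true] := ⟨by decide, by decide, by decide, cyc3_mem_segmentGroup_four⟩
  have he : ringGate 4 57 (by omega) isCellReversible_57 ∈ G := ringGate_mem _
  have hs : ringShift 4 ∈ G := ringShift_mem _
  let z : ZMod 4 → Bool := ringWord4 false true false true
  let R : Bool → Bool → Bool → Bool → Prop := fun a b c d =>
    Cyc3Rel G z (ringWord4 a b c d)
  have hz : R false true false true := Cyc3Rel.refl G _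
  have h0001 : R false false false true := (h₀.rel_left.ring (by omega)).symm
  have h0111 : R false true true true := h₀.rotate.rel_left.ring (by omega)
  -- The double shift fixes 0101. The single shift is available only once the shift-invariant word
  -- 0000 is in the class.
  have hs2 : ∀ {a b c d}, R a b c d → R c d a b := fun {a b c d} h => by
    have := Cyc3Rel.apply_of_apply (mul_mem hs hs) hz
      (by rw [Perm.mul_apply, ringShift_ringWord4, ringShift_ringWord4]; exact hz) h
    rwa [Perm.mul_apply, ringShift_ringWord4, ringShift_ringWord4] at this
  have hE : ∀ {a b c d}, R a b c d → R (xor a (d || !b)) b c d := fun {a b c d} h => by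
    have := Cyc3Rel.apply_of_apply he hz (by rw [ringGate_ringWord4]; exact hs2 h0111) h
    rwa [ringGate_ringWord4] at this
  -- The gate at cell 3 maps 0101 to 0100, already in the class, and 0001 to 0000.
  have h0000 : R false false false false := by
    have hg : ∀ a b c d : Bool, cellGate (2 : ZMod 4) 3 0 (by decide) (by decide)
        (ringWord4 a b c d) = ringWord4 a b c (xor d (c || !a)) := by
      intro a b c d
      funext i
      change Fin 4 at i
      fin_cases i <;> rfl
    have := Cyc3Rel.apply_of_apply (cellGate_mem_ringGroup (n := 4) (by omega) (l := 2) (c := 3)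
      (r := 0) (by decide) (by decide) (by decide) (by decide)) hz
      (by rw [hg]; exact hs2 h0001) h0001
    rwa [hg] at this
  have hS : ∀ {a b c d}, R a b c d → R b c d a := fun {a b c d} h => by
    have := Cyc3Rel.apply_of_apply hs h0000 (by rw [ringShift_ringWord4]; exact h0000) h
    rwa [ringShift_ringWord4] at this
  have h1000 : R true false false false := hE h0000
  have h1001 := hE h0001
  have h1010 : R true false true false := hE (hS (hS h1000))
  have h1101 : R true true false true := hE hz
  have h1111 : R true true true true := hE h0111
  have key : ∀ x, Cyc3Rel G z x := by
    intro x
    obtain ⟨a, b, c, d, rfl⟩ := exists_eq_ringWord4 x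
    change R a b c d
    cases a <;> cases b <;> cases c <;> cases d <;>
      first
        | assumption
        | exact hS ‹_›
        | exact hS (hS ‹_›)
        | exact hS (hS (hS ‹_›))
  exact (key x).symm.trans (key y)

theorem ringGroup_eq_alternatingGroup {n : ℕ} [NeZero n] (hn : 4 ≤ n) :
    ringGroup n (by omega) = alternatingGroup (ZMod n → Bool) := by
  apply le_antisymm
  · rw [ringGroup, Subgroup.closure_le]
    rintro _ (rfl | rfl)
    · exact Perm.mem_alternatingGroup.mpr (sign_ringGate hn _)
    · exact Perm.mem_alternatingGroup.mpr (sign_ringShift (by omega))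
  · apply alternatingGroup_le_of_cyc3Rel
    rcases hn.eq_or_lt with rfl | hn
    · exact cyc3Rel_ringGroup_four
    · exact cyc3Rel_ringGroup hn

/-! ### Rule 99 by complementation, and the theorem -/

/-- The permutation of words which flips all cells. -/
def flipAll (ι : Type*) : Perm (ι → Bool) :=
  Function.Involutive.toPerm (fun x i => !x i) fun x => by simp

theorem wolframRule_99 (l c r : Bool) : wolframRule 99 l c r = !wolframRule 57 (!l) (!c) (!r) := by
  revert l c r; decide

theorem flipAll_conj_ringGate {n : ℕ} (hn : 2 ≤ n) :
    MulAut.conj (flipAll (ZMod n)) (ringGate n 57 hn isCellReversible_57) =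
      ringGate n 99 hn isCellReversible_99 := by
  ext x i
  change (!ringGate n 57 hn isCellReversible_57 (fun i => !x i) i) = _
  by_cases hi : i = 0
  · subst hi
    rw [ringGate_apply_zero, ringGate_apply_zero, wolframRule_99]
  · rw [ringGate_apply_of_ne _ _ _ hi, ringGate_apply_of_ne _ _ _ hi, Bool.not_not]

theorem flipAll_conj_ringShift (n : ℕ) :
    MulAut.conj (flipAll (ZMod n)) (ringShift n) = ringShift n := by
  ext x i
  exact Bool.not_not _

theorem mainTheorem4 (n : ℕ) [NeZero n] (hn : 4 ≤ n) :
    Subgroup.closure {ringGate n 57 (le_trans (by decide) hn) isCellReversible_57, ringShift n} =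
        alternatingGroup (ZMod n → Bool) ∧
      Subgroup.closure {ringGate n 99 (le_trans (by decide) hn) isCellReversible_99, ringShift n} =
        alternatingGroup (ZMod n → Bool) := by
  have h57 := ringGroup_eq_alternatingGroup hn
  refine ⟨h57, ?_⟩
  -- The group of rule 99 is the conjugate of the group of rule 57 by the complement, and the
  -- alternating group is normal.
  rw [← flipAll_conj_ringGate, ← flipAll_conj_ringShift, ← MulEquiv.coe_toMonoidHom,
    ← Set.image_pair, ← MonoidHom.map_closure]
  change (ringGroup n _).map _ = _
  rw [h57]
  exact Subgroup.Normal.map_conj_eq _ _
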